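/- All rings are commutative with $1\neq 0$, and subrings are unital. A maximal subring of a ring $R$ is a proper subring of $R$ that is maximal with respect to inclusion among all proper subrings of $R$. Let $F\subseteq E$ be an extension of fields, let $n\ge 0$, and let $\alpha_1,\ldots,\alpha_n\in E$. 1. The field $K=F(\alpha_1,\ldots,\alpha_n)$ has only finitely many maximal subrings if and only if $F$ has only finitely many maximal subrings and $K/F$ is a finite extension. 2. The ring $R=F[\alpha_1,\ldots,\alpha_n]$ has only finitely many maximal subrings if and only if $F$ has only finitely many maximal subrings and each $\alpha_i$ is algebraic over $F$. Moreover, each $\alpha_i$ is algebraic over $F$ if and only if $R$ is a field and $[R:F]$ is finite. -/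

import Mathlib

/-- The set of all maximal subrings of a commutative ring `R`: the proper (unital) subrings
that are maximal for inclusion among the proper subrings of `R`. -/
def RgMax (R : Type*) [CommRing R] : Set (Subring R) := {S | IsCoatom S}

/-! The first half is that a field `K` with finitely many maximal subrings is algebraic over some
`𝔽_p` (`exists_isAlgebraic_zmod_of_RgMax_finite`). Otherwise `K` is algebraic over a polynomial ring
over `ℤ` or `𝔽_p` that is not a field. This is a UFD with finitely many units, so Euclid's argument
gives infinitely many primes `π` up to units. For each, Zorn's lemma yields a maximal subring
omitting `1/π` but containing `1/b` whenever `π ∤ b`, so distinct primes give distinct subrings.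
Hence `K` is algebraic over every subfield.

The second half is that finiteness passes both ways along a finite extension `K/F`
(`RgMax_finite_iff_of_finiteDimensional`). By the first half both fields may be taken algebraic over
`𝔽_p`. Maximal subrings then correspond to the primes `l` with finite positive exponent in the
Steinitz degree, and passing from `F` to `K` changes exponents only at primes `l ≤ [K:F]`.

For the ring `R`, infinitely many maximal ideals would produce infinitely many maximal subrings.
Being a Jacobson domain, `R` is therefore a field, and it is finite over `F` by Zariski's lemma. -/

/-! ### Finitely generated algebras over a field -/

/-- A proper subring over which the whole ring is finitely generated lies in a maximal subring. -/
lemma exists_mem_RgMax_of_closure_union_eq_top {R : Type*} [CommRing R] {B : Subring R}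
    (s : Finset R) (hs : ¬ (s : Set R) ⊆ B) (htop : Subring.closure (B ∪ s : Set R) = ⊤) :
    ∃ S ∈ RgMax R, B ≤ S ∧ ¬ (s : Set R) ⊆ S := by
  obtain ⟨S, hBS, hS⟩ := zorn_le_nonempty₀ {S : Subring R | B ≤ S ∧ ¬ (s : Set R) ⊆ S} (by
    intro c hc hchain y hy
    refine ⟨sSup c, ⟨(hc hy).1.trans (le_sSup hy), fun h => ?_⟩, fun z hz => le_sSup hz⟩
    have hdir : DirectedOn (· ≤ ·) c := hchain.directedOn
    -- As `s` is finite, a directed union containing it has a member containing it.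
    have hcov : (s : Set R) ⊆ ⋃ S ∈ c, (S : Set R) := by
      intro x hx
      obtain ⟨T, hT, hxT⟩ := (Subring.mem_sSup_of_directedOn ⟨y, hy⟩ hdir).1 (h hx)
      exact Set.mem_biUnion hT hxT
    obtain ⟨T, hT, hsT⟩ := DirectedOn.exists_mem_subset_of_finset_subset_biUnion
      (f := fun S : Subring R => (S : Set R)) ⟨y, hy⟩ hdir hcov
    exact (hc hT).2 hsT) B ⟨le_rfl, hs⟩
  refine ⟨S, ⟨fun h => hS.prop.2 (by simp [h]), fun T hST => ?_⟩, hBS, hS.prop.2⟩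
  by_contra hT
  refine hST.not_ge (hS.le_of_ge ⟨hBS.trans hST.le, fun hsT => hT ?_⟩ hST.le)
  rw [eq_top_iff, ← htop, Subring.closure_le]
  exact Set.union_subset (hBS.trans hST.le) hsT

/-- A finitely generated algebra over a field with infinitely many maximal ideals has infinitely
many maximal subrings. -/
lemma RgMax_infinite_of_infinite_maximal (F : Type*) {R : Type*} [Field F] [CommRing R]
    [Algebra F R] [Algebra.FiniteType F R] (h : {m : Ideal R | m.IsMaximal}.Infinite) :
    (RgMax R).Infinite := by
  obtain ⟨s, hs⟩ := Algebra.FiniteType.out (R := F) (A := R)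
  let e : ℕ ↪ {m : Ideal R | m.IsMaximal} := h.natEmbedding
  have hmax (i : ℕ) : (e i : Ideal R).IsMaximal := (e i).2
  have hsup {i j : ℕ} (hij : i ≠ j) : (e i : Ideal R) ⊔ e j = ⊤ :=
    Ideal.IsMaximal.coprime_of_ne (hmax i) (hmax j)
      fun hh => hij (e.injective (Subtype.ext hh))
  -- Two maximal ideals are needed for `F + I i` to be proper even when all residue fields equal
  -- `F`. Disjoint pairs keep the `I i` pairwise comaximal, so no proper subring contains two of
  -- them.
  let I (i : ℕ) : Ideal R := (e (2 * i) : Ideal R) ⊓ e (2 * i + 1)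
  have hI {i j : ℕ} (hij : i ≠ j) : I i ⊔ I j = ⊤ := by
    rw [← Ideal.isCoprime_iff_sup_eq]
    have hc {a b : ℕ} (hab : a ≠ b) : IsCoprime (e a : Ideal R) (e b) :=
      Ideal.isCoprime_iff_sup_eq.2 (hsup hab)
    have key (a : ℕ) (h1 : a ≠ 2 * i) (h2 : a ≠ 2 * i + 1) : IsCoprime (I i) (e a) := by
      rw [Ideal.isCoprime_iff_exists]
      have := (hc h1).mul_right (hc h2)
      obtain ⟨x, hx, y, hy, hxy⟩ := Ideal.isCoprime_iff_exists.1 this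
      exact ⟨y, Ideal.mul_le_inf hy, x, hx, by rw [add_comm, hxy]⟩
    have := (key (2 * j) (by omega) (by omega)).mul_right (key (2 * j + 1) (by omega) (by omega))
    obtain ⟨x, hx, y, hy, hxy⟩ := Ideal.isCoprime_iff_exists.1 this
    exact Ideal.isCoprime_iff_exists.2 ⟨x, hx, y, Ideal.mul_le_inf hy, hxy⟩
  let B (i : ℕ) : Subring R := ((algebraMap F (R ⧸ I i)).range).comap (Ideal.Quotient.mk (I i))
  have hIB (i : ℕ) {x : R} (hx : x ∈ I i) : x ∈ B i :=
    ⟨0, by rw [map_zero, Ideal.Quotient.eq_zero_iff_mem.2 hx]⟩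
  have hFB (i : ℕ) (c : F) : algebraMap F R c ∈ B i := ⟨c, rfl⟩
  have hBtop (i : ℕ) : B i ≠ ⊤ := by
    intro htop
    have h1 : (1 : R) ∈ (e (2 * i) : Ideal R) ⊔ e (2 * i + 1) := by
      rw [hsup (by omega)]; trivial
    obtain ⟨x, hx, y, hy, hxy⟩ := Submodule.mem_sup.1 h1
    obtain ⟨c, hc⟩ : x ∈ B i := htop ▸ Subring.mem_top x
    have hcx : algebraMap F R c - x ∈ I i := Ideal.Quotient.eq.1 hc
    have hcm : algebraMap F R c ∈ (e (2 * i) : Ideal R) := by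
      simpa using add_mem hcx.1 hx
    have hc0 : c = 0 := by
      by_contra hc0
      exact (hmax (2 * i)).ne_top
        (Ideal.eq_top_of_isUnit_mem _ hcm ((IsUnit.mk0 c hc0).map (algebraMap F R)))
    have hx' : x ∈ (e (2 * i + 1) : Ideal R) := by
      have := hcx.2
      rw [hc0, map_zero, zero_sub] at this
      exact neg_mem_iff.1 this
    exact (hmax (2 * i + 1)).ne_top ((Ideal.eq_top_iff_one _).2 (hxy ▸ add_mem hx' hy))
  have hgen (i : ℕ) (T : Subring R) (hBT : B i ≤ T) (hsT : (s : Set R) ⊆ T) : T = ⊤ := by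
    rw [eq_top_iff]
    intro x _
    have hx : x ∈ Algebra.adjoin F (s : Set R) := hs ▸ Algebra.mem_top
    induction hx using Algebra.adjoin_induction with
    | mem x hx => exact hsT hx
    | algebraMap c => exact hBT (hFB i c)
    | add x y _ _ hx hy => exact add_mem (hx trivial) (hy trivial)
    | mul x y _ _ hx hy => exact mul_mem (hx trivial) (hy trivial)
  have hex (i : ℕ) : ∃ S ∈ RgMax R, B i ≤ S := by
    obtain ⟨S, hS, hBS, -⟩ := exists_mem_RgMax_of_closure_union_eq_top (B := B i) s
      (fun hh => hBtop i (hgen i _ le_rfl hh))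
      (hgen i _ (Set.subset_union_left.trans Subring.subset_closure)
        (Set.subset_union_right.trans Subring.subset_closure))
    exact ⟨S, hS, hBS⟩
  choose S hS hBS using hex
  refine Set.infinite_of_injective_forall_mem (f := S) (fun i j hij => ?_) hS
  by_contra hne
  refine (hS i).1 ((eq_top_iff).2 fun x _ => ?_)
  have hx : x ∈ I i ⊔ I j := by rw [hI hne]; trivial
  obtain ⟨a, ha, b, hb, rfl⟩ := Submodule.mem_sup.1 hx
  exact add_mem (hBS i (hIB i ha)) (hij ▸ hBS j (hIB j hb))

/-- A Jacobson domain with finitely many maximal ideals is a field. -/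
lemma IsJacobsonRing.isField_of_finite_maximal {R : Type*} [CommRing R] [IsDomain R]
    [IsJacobsonRing R] (h : {m : Ideal R | m.IsMaximal}.Finite) : IsField R := by
  have hj : (⊥ : Ideal R).jacobson = ⊥ :=
    IsJacobsonRing.out ‹_› (Ideal.isPrime_bot : (⊥ : Ideal R).IsPrime).isRadical
  have hle : h.toFinset.prod id ≤ (⊥ : Ideal R) := by
    rw [← hj]
    refine le_sInf fun m hm => Ideal.prod_le_inf.trans (Finset.inf_le (f := id) ?_)
    simpa using hm.2
  obtain ⟨m, hm, hm0⟩ := Ideal.isPrime_bot.prod_le.1 hle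
  have hm' : m.IsMaximal := by simpa using hm
  rw [Ring.isField_iff_maximal_bot]
  rw [id, le_bot_iff] at hm0
  exact hm0 ▸ hm'

/-- A domain that is finitely generated over a field and has finitely many maximal subrings is a
field. -/
lemma isField_of_RgMax_finite (F : Type*) {R : Type*} [Field F] [CommRing R] [IsDomain R]
    [Algebra F R] [Algebra.FiniteType F R] (h : (RgMax R).Finite) : IsField R := by
  have : IsJacobsonRing R := isJacobsonRing_of_finiteType (A := F)
  refine IsJacobsonRing.isField_of_finite_maximal ?_
  by_contra hinf
  exact RgMax_infinite_of_infinite_maximal F hinf h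

/-! ### Fields that are not algebraic over a finite field -/

/-- For a prime element `π` of `A`, the elements of `K` that become integral over `A` after
multiplication by an element of `A` not divisible by `π`. -/
def integralAwayFrom {A : Type*} (K : Type*) [CommRing A] [Field K] [Algebra A K] {π : A}
    (hπ : Prime π) : Subring K where
  carrier := {x | ∃ b : A, ¬ π ∣ b ∧ IsIntegral A (b • x)}
  one_mem' := ⟨1, fun h => hπ.not_isUnit (isUnit_of_dvd_one h), by
    rw [one_smul]; exact isIntegral_one⟩
  zero_mem' := ⟨1, fun h => hπ.not_isUnit (isUnit_of_dvd_one h), by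
    rw [smul_zero]; exact isIntegral_zero⟩
  mul_mem' := by
    rintro x y ⟨b, hb, hbx⟩ ⟨c, hc, hcy⟩
    refine ⟨b * c, fun h => (hπ.dvd_or_dvd h).elim hb hc, ?_⟩
    rw [← smul_mul_smul_comm]
    exact hbx.mul hcy
  add_mem' := by
    rintro x y ⟨b, hb, hbx⟩ ⟨c, hc, hcy⟩
    refine ⟨b * c, fun h => (hπ.dvd_or_dvd h).elim hb hc, ?_⟩
    have : (b * c) • (x + y) = c • b • x + b • c • y := by
      simp only [Algebra.smul_def, map_mul]; ring
    rw [this]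
    exact (hbx.smul c).add (hcy.smul b)
  neg_mem' := by
    rintro x ⟨b, hb, hbx⟩
    exact ⟨b, hb, by rw [smul_neg]; exact hbx.neg⟩

lemma inv_mem_integralAwayFrom {A K : Type*} [CommRing A] [Field K] [Algebra A K]
    [FaithfulSMul A K] {π : A} (hπ : Prime π) {b : A} (hb : ¬ π ∣ b) :
    (algebraMap A K b)⁻¹ ∈ integralAwayFrom K hπ := by
  refine ⟨b, hb, ?_⟩
  have hb0 : algebraMap A K b ≠ 0 := by
    rw [Ne, FaithfulSMul.algebraMap_eq_zero_iff]
    rintro rfl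
    exact hb (dvd_zero π)
  rw [Algebra.smul_def, mul_inv_cancel₀ hb0]
  exact isIntegral_one

/-- If `b/π` is integral, it lies in the fraction field of `A`, hence in `A`, so `π ∣ b`. -/
lemma inv_notMem_integralAwayFrom {A K : Type*} [CommRing A] [IsDomain A] [IsIntegrallyClosed A]
    [Field K] [Algebra A K] [FaithfulSMul A K] {π : A} (hπ : Prime π) :
    (algebraMap A K π)⁻¹ ∉ integralAwayFrom K hπ := by
  rintro ⟨b, hb, hint⟩
  let := FractionRing.liftAlgebra A K
  let y : FractionRing A := algebraMap A _ b * (algebraMap A _ π)⁻¹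
  have hy : algebraMap (FractionRing A) K y = b • (algebraMap A K π)⁻¹ := by
    simp only [y, map_mul, map_inv₀, Algebra.smul_def, ← IsScalarTower.algebraMap_apply]
  rw [← hy, isIntegral_algebraMap_iff (algebraMap (FractionRing A) K).injective] at hint
  obtain ⟨c, hc⟩ := IsIntegrallyClosed.isIntegral_iff.1 hint
  have hπ0 : algebraMap A (FractionRing A) π ≠ 0 := by
    simpa using hπ.ne_zero
  refine hb ⟨c, ?_⟩
  apply FaithfulSMul.algebraMap_injective A (FractionRing A)
  rw [map_mul, hc, mul_comm, inv_mul_cancel_right₀ hπ0]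

/-- Adjoining `1/π` to `integralAwayFrom K hπ` gives all of `K`: if `a • x` is integral and `a = π ^
n * b` with `π ∤ b`, then `π ^ n • x` already lies in the subring. -/
lemma exists_mem_RgMax_of_prime {A K : Type*} [CommRing A] [IsDomain A]
    [UniqueFactorizationMonoid A] [Field K] [Algebra A K] [FaithfulSMul A K]
    [Algebra.IsAlgebraic A K] {π : A} (hπ : Prime π) :
    ∃ S ∈ RgMax K, (algebraMap A K π)⁻¹ ∉ S ∧
      ∀ b : A, ¬ π ∣ b → (algebraMap A K b)⁻¹ ∈ S := by
  obtain ⟨S, hS, hBS, hsS⟩ := exists_mem_RgMax_of_closure_union_eq_top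
    (B := integralAwayFrom K hπ) {(algebraMap A K π)⁻¹}
    (by simpa using inv_notMem_integralAwayFrom (K := K) hπ) (by
      rw [eq_top_iff]
      intro x _
      obtain ⟨a, ha, hint⟩ := (Algebra.IsAlgebraic.isAlgebraic (R := A) x).exists_integral_multiple
      obtain ⟨n, b, hb, rfl⟩ := WfDvdMonoid.max_power_factor ha hπ.irreducible
      have hπ0 : algebraMap A K π ≠ 0 := by
        simpa [FaithfulSMul.algebraMap_eq_zero_iff] using hπ.ne_zero
      have hx : π ^ n • x ∈ integralAwayFrom K hπ := ⟨b, hb, by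
        rwa [smul_smul, mul_comm]⟩
      have hx' : x = (π ^ n • x) * (algebraMap A K π)⁻¹ ^ n := by
        rw [Algebra.smul_def, map_pow, inv_pow]
        field_simp
      rw [hx']
      refine mul_mem (Subring.subset_closure (Or.inl hx)) (pow_mem (Subring.subset_closure ?_) n)
      exact Or.inr (by simp))
  exact ⟨S, hS, by simpa using hsS, fun b hb => hBS (inv_mem_integralAwayFrom hπ hb)⟩

/-- A unique factorization domain with finitely many units that is not a field has infinitely many
principal prime ideals. -/
lemma infinite_span_prime {A : Type*} [CommRing A] [IsDomain A] [UniqueFactorizationMonoid A]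
    [Finite Aˣ] (hA : ¬ IsField A) :
    {I : Ideal A | ∃ π : A, Prime π ∧ I = Ideal.span {π}}.Infinite := by
  intro hfin
  have hex (I : Ideal A) (hI : ∃ π : A, Prime π ∧ I = Ideal.span {π}) :
      ∃ π : A, Prime π ∧ I = Ideal.span {π} := hI
  choose! g hg using hex
  let P : A := ∏ I ∈ hfin.toFinset, g I
  have hdvd {q : A} (hq : Prime q) : q ∣ P := by
    have hmem : ∃ π : A, Prime π ∧ Ideal.span {q} = Ideal.span {π} := ⟨q, hq, rfl⟩
    have h1 : q ∣ g (Ideal.span {q}) := by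
      have hself := Ideal.mem_span_singleton_self (g (Ideal.span {q}))
      rw [← (hg _ hmem).2] at hself
      exact Ideal.mem_span_singleton.1 hself
    exact h1.trans (Finset.dvd_prod_of_mem g (by simpa using hmem))
  have hP0 : P ≠ 0 := Finset.prod_ne_zero_iff.2 fun I hI => (hg I (by simpa using hI)).1.ne_zero
  have hPu : ¬ IsUnit P := by
    intro hu
    obtain ⟨a, ha0, hau⟩ := Ring.exists_not_isUnit_of_not_isField hA
    obtain ⟨q, hq, -⟩ := WfDvdMonoid.exists_irreducible_factor hau ha0
    exact hq.not_isUnit (isUnit_of_dvd_unit (hdvd hq.prime) hu)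
  -- Every prime divides `P`, so none divides `1 + P ^ (k + 1)`. These units are distinct because
  -- `P` is a nonzero nonunit.
  have hunit (k : ℕ) : IsUnit (1 + P ^ (k + 1)) := by
    by_contra hu
    have h0 : 1 + P ^ (k + 1) ≠ 0 := by
      intro h0
      refine hPu (isUnit_of_mul_isUnit_left (y := P ^ k) ?_)
      rw [← pow_succ', eq_neg_of_add_eq_zero_right h0]
      exact isUnit_one.neg
    obtain ⟨q, hq, hqd⟩ := WfDvdMonoid.exists_irreducible_factor hu h0
    refine hq.not_isUnit (isUnit_of_dvd_one ?_)
    exact (dvd_add_left (dvd_pow (hdvd hq.prime) k.succ_ne_zero)).1 hqd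
  refine not_injective_infinite_finite (fun k => (hunit k).unit) fun i j hij => ?_
  have h1 : P ^ (i + 1) = P ^ (j + 1) := by
    have := congrArg Units.val hij
    simpa using this
  have := pow_injective_of_not_isUnit hPu hP0 h1
  omega

lemma RgMax_infinite_of_isAlgebraic_ufd (A : Type*) {K : Type*} [CommRing A] [IsDomain A]
    [UniqueFactorizationMonoid A] [Finite Aˣ] [Field K] [Algebra A K] [FaithfulSMul A K]
    [Algebra.IsAlgebraic A K] (hA : ¬ IsField A) : (RgMax K).Infinite := by
  have hinf := (infinite_span_prime hA).to_subtype
  let T := {I : Ideal A | ∃ π : A, Prime π ∧ I = Ideal.span {π}}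
  choose g hg hgI using fun I : T => I.2
  choose S hS h1 h2 using fun I : T => exists_mem_RgMax_of_prime (K := K) (hg I)
  refine Set.infinite_of_injective_forall_mem (f := S) (fun I J hIJ => ?_) hS
  by_contra hne
  have key : ¬ g I ∣ g J := fun hd => hne <| Subtype.ext <| by
    rw [hgI I, hgI J, Ideal.span_singleton_eq_span_singleton]
    exact (hg I).irreducible.associated_of_dvd (hg J).irreducible hd
  exact h1 J (hIJ ▸ h2 I _ key)

lemma MvPolynomial.finite_units {σ R : Type*} [CommRing R] [IsReduced R] [Finite Rˣ] :
    Finite (MvPolynomial σ R)ˣ := by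
  refine Finite.of_surjective (Units.map (C : R →+* MvPolynomial σ R).toMonoidHom) fun u => ?_
  obtain ⟨r, hr, hu⟩ := isUnit_iff_eq_C_of_isReduced.1 u.isUnit
  exact ⟨hr.unit, Units.ext hu.symm⟩

lemma MvPolynomial.isEmpty_and_isField_of_isField {σ R : Type*} [CommRing R] [Nontrivial R]
    (h : IsField (MvPolynomial σ R)) : IsEmpty σ ∧ IsField R := by
  have hσ : IsEmpty σ := by
    refine ⟨fun i => ?_⟩
    obtain ⟨q, hq⟩ := h.mul_inv_cancel (X_ne_zero i : (X i : MvPolynomial σ R) ≠ 0)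
    simpa using congrArg (eval 0) hq
  exact ⟨hσ, (isEmptyRingEquiv R σ).symm.toMulEquiv.isField h⟩

/-- A transcendence basis makes `K` algebraic over a polynomial ring over `R`; this is a field only
if the basis is empty and `R` is a field, which `h` excludes. -/
lemma RgMax_infinite_of_finite_units (R : Type*) {K : Type*} [CommRing R] [IsDomain R]
    [UniqueFactorizationMonoid R] [Finite Rˣ] [Field K] [Algebra R K] [FaithfulSMul R K]
    (h : IsField R → ¬ Algebra.IsAlgebraic R K) : (RgMax K).Infinite := by
  obtain ⟨s, hs⟩ := exists_isTranscendenceBasis R K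
  let e := hs.1.aevalEquiv
  have := hs.isAlgebraic
  have : UniqueFactorizationMonoid (Algebra.adjoin R (Set.range (Subtype.val : s → K))) :=
    e.toMulEquiv.uniqueFactorizationMonoid inferInstance
  have : Finite (Algebra.adjoin R (Set.range (Subtype.val : s → K)))ˣ :=
    have := MvPolynomial.finite_units (σ := s) (R := R)
    Finite.of_equiv _ (Units.mapEquiv e.toMulEquiv).toEquiv
  refine RgMax_infinite_of_isAlgebraic_ufd (Algebra.adjoin R (Set.range (Subtype.val : s → K)))
    fun hfield => ?_
  obtain ⟨hempty, hR⟩ :=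
    MvPolynomial.isEmpty_and_isField_of_isField (e.toMulEquiv.isField hfield)
  exact h hR (hs.isEmpty_iff_isAlgebraic.1 hempty)

/-- A field with finitely many maximal subrings is algebraic over a finite prime field. -/
lemma exists_isAlgebraic_zmod_of_RgMax_finite {K : Type*} [Field K] (h : (RgMax K).Finite) :
    ∃ p : ℕ, ∃ _ : Fact p.Prime, ∃ _ : Algebra (ZMod p) K, Algebra.IsAlgebraic (ZMod p) K := by
  obtain ⟨p, hp⟩ := CharP.exists K
  rcases CharP.char_is_prime_or_zero K p with hpp | rfl
  · have : Fact p.Prime := ⟨hpp⟩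
    let := ZMod.algebra K p
    refine ⟨p, ⟨hpp⟩, inferInstance, ?_⟩
    by_contra hna
    exact RgMax_infinite_of_finite_units (ZMod p) (fun _ => hna) h
  · have := CharP.charP_to_charZero K
    exact (RgMax_infinite_of_finite_units ℤ (fun hZ => (Int.not_isField hZ).elim) h).elim

/-! ### Finite subfields detected by roots of unity -/

lemma Nat.Prime.pow_dvd_lcm {l k m n : ℕ} (hl : l.Prime) (hm : 0 < m) (hn : 0 < n)
    (h : l ^ k ∣ m.lcm n) : l ^ k ∣ m ∨ l ^ k ∣ n := by
  rw [hl.pow_dvd_iff_le_factorization (Nat.lcm_pos hm hn).ne',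
    Nat.factorization_lcm hm.ne' hn.ne', Finsupp.sup_apply, le_sup_iff] at h
  rwa [hl.pow_dvd_iff_le_factorization hm.ne', hl.pow_dvd_iff_le_factorization hn.ne']

section PrimitiveRoots

variable {K : Type*} [Field K] {p : ℕ}

lemma pow_pow_eq_self_of_dvd {x : K} {m n : ℕ} (h : x ^ p ^ m = x) (hmn : m ∣ n) :
    x ^ p ^ n = x := by
  obtain ⟨k, rfl⟩ := hmn
  induction k with
  | zero => simp
  | succ k ih => rw [Nat.mul_succ, pow_add, pow_mul, ih, h]

/-- The subring `B` contains a primitive root of unity of order `p ^ n - 1`; in characteristic `p`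
this means that `B` contains a field with `p ^ n` elements. -/
def HasPrimitiveRoot (p : ℕ) (B : Subring K) (n : ℕ) : Prop :=
  ∃ u ∈ B, IsPrimitiveRoot u (p ^ n - 1)

lemma HasPrimitiveRoot.mono {B C : Subring K} (hBC : B ≤ C) {n : ℕ}
    (h : HasPrimitiveRoot p B n) : HasPrimitiveRoot p C n :=
  let ⟨u, hu, hp⟩ := h
  ⟨u, hBC hu, hp⟩

variable [Fact p.Prime]

lemma pow_pow_sub_one_pos {n : ℕ} (hn : 0 < n) : 0 < p ^ n - 1 := by
  have := Nat.one_lt_pow hn.ne' (Fact.out : p.Prime).one_lt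
  omega

lemma pow_sub_one_dvd_iff {m n : ℕ} :
    p ^ m - 1 ∣ p ^ n - 1 ↔ m ∣ n := by
  refine ⟨fun h => ?_, fun h => ?_⟩
  · have h1 := Nat.gcd_eq_left h
    rw [Nat.pow_sub_one_gcd_pow_sub_one] at h1
    have hp := (Fact.out : p.Prime)
    have h2 : p ^ m.gcd n = p ^ m := by
      have := Nat.pow_pos (n := m) hp.pos
      have := Nat.pow_pos (n := m.gcd n) hp.pos
      omega
    exact Nat.gcd_eq_left_iff_dvd.1 (Nat.pow_right_injective hp.two_le h2)
  · obtain ⟨k, rfl⟩ := h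
    rw [pow_mul]
    simpa using Nat.sub_dvd_pow_sub_pow (p ^ m) 1 k

lemma IsPrimitiveRoot.pow_prime_pow_eq_self {u : K} {n : ℕ} (hu : IsPrimitiveRoot u (p ^ n - 1)) :
    u ^ p ^ n = u := by
  rw [← Nat.sub_add_cancel (Nat.one_le_pow n p (Fact.out : p.Prime).pos), pow_succ, hu.pow_eq_one,
    one_mul]

lemma IsPrimitiveRoot.dvd_of_pow_prime_pow_eq_self {u : K} {m n : ℕ} (hm : 0 < m)
    (hu : IsPrimitiveRoot u (p ^ m - 1)) (h : u ^ p ^ n = u) : m ∣ n := by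
  rw [← pow_sub_one_dvd_iff (p := p)]
  refine hu.dvd_of_pow_eq_one _ ?_
  have hu0 : u ≠ 0 := hu.ne_zero (pow_pow_sub_one_pos hm).ne'
  rw [← Nat.sub_add_cancel (Nat.one_le_pow n p (Fact.out : p.Prime).pos), pow_succ] at h
  exact mul_right_cancel₀ hu0 (h.trans (one_mul u).symm)

lemma HasPrimitiveRoot.of_dvd {B : Subring K} {m n : ℕ} (hn : 0 < n) (hmn : m ∣ n)
    (h : HasPrimitiveRoot p B n) : HasPrimitiveRoot p B m := by
  obtain ⟨u, hu, hp⟩ := h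
  obtain ⟨k, hk⟩ := (pow_sub_one_dvd_iff (p := p)).2 hmn
  exact ⟨u ^ k, pow_mem hu k, hp.pow (pow_pow_sub_one_pos hn) (by rw [hk, mul_comm])⟩

lemma HasPrimitiveRoot.mem {B : Subring K} {n : ℕ} (hn : 0 < n) (h : HasPrimitiveRoot p B n)
    {x : K} (hx : x ^ p ^ n = x) : x ∈ B := by
  obtain ⟨u, hu, hp⟩ := h
  by_cases hx0 : x = 0
  · exact hx0 ▸ zero_mem B
  · have : NeZero (p ^ n - 1) := ⟨(pow_pow_sub_one_pos hn).ne'⟩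
    rw [← Nat.sub_add_cancel (Nat.one_le_pow n p (Fact.out : p.Prime).pos), pow_succ] at hx
    obtain ⟨i, -, rfl⟩ := hp.eq_pow_of_pow_eq_one
      (mul_right_cancel₀ hx0 (hx.trans (one_mul x).symm))
    exact pow_mem hu i

/-- The elements of `K` lying in a finite subfield whose degree is not divisible by `l ^ (k + 1)`. -/
def subringNotDvd (K : Type*) [Field K] (p : ℕ) [Fact p.Prime] [CharP K p] (l : ℕ) (hl : l.Prime)
    (k : ℕ) : Subring K :=
  have hlcm {m n : ℕ} (hm : 0 < m ∧ ¬ l ^ (k + 1) ∣ m) (hn : 0 < n ∧ ¬ l ^ (k + 1) ∣ n) :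
      0 < m.lcm n ∧ ¬ l ^ (k + 1) ∣ m.lcm n :=
    ⟨Nat.lcm_pos hm.1 hn.1, fun h => (hl.pow_dvd_lcm hm.1 hn.1 h).elim hm.2 hn.2⟩
  have h1 : 0 < 1 ∧ ¬ l ^ (k + 1) ∣ 1 :=
    ⟨one_pos, fun h => (Nat.one_lt_pow k.succ_ne_zero hl.one_lt).ne' (Nat.dvd_one.1 h)⟩
  { carrier := {x | ∃ n, (0 < n ∧ ¬ l ^ (k + 1) ∣ n) ∧ x ^ p ^ n = x}
    one_mem' := ⟨1, h1, one_pow _⟩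
    zero_mem' := ⟨1, h1, zero_pow (pow_ne_zero _ (Fact.out : p.Prime).ne_zero)⟩
    mul_mem' := by
      rintro x y ⟨m, hm, hx⟩ ⟨n, hn, hy⟩
      refine ⟨m.lcm n, hlcm hm hn, ?_⟩
      rw [mul_pow, pow_pow_eq_self_of_dvd hx (Nat.dvd_lcm_left m n),
        pow_pow_eq_self_of_dvd hy (Nat.dvd_lcm_right m n)]
    add_mem' := by
      rintro x y ⟨m, hm, hx⟩ ⟨n, hn, hy⟩
      refine ⟨m.lcm n, hlcm hm hn, ?_⟩
      rw [add_pow_char_pow, pow_pow_eq_self_of_dvd hx (Nat.dvd_lcm_left m n),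
        pow_pow_eq_self_of_dvd hy (Nat.dvd_lcm_right m n)]
    neg_mem' := by
      rintro x ⟨m, hm, hx⟩
      refine ⟨m, hm, ?_⟩
      rw [← iterateFrobenius_def, map_neg, iterateFrobenius_def, hx] }

lemma IsPrimitiveRoot.mem_subringNotDvd_iff [CharP K p] {l : ℕ} {hl : l.Prime} {k n : ℕ}
    (hn : 0 < n) {u : K} (hu : IsPrimitiveRoot u (p ^ n - 1)) :
    u ∈ subringNotDvd K p l hl k ↔ ¬ l ^ (k + 1) ∣ n := by
  refine ⟨?_, fun h => ⟨n, ⟨hn, h⟩, hu.pow_prime_pow_eq_self⟩⟩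
  rintro ⟨m, ⟨-, hm⟩, hum⟩ h
  exact hm (h.trans (hu.dvd_of_pow_prime_pow_eq_self hn hum))

lemma subringNotDvd_ne_top [CharP K p] {l : ℕ} {hl : l.Prime} {k : ℕ}
    (h : HasPrimitiveRoot p (⊤ : Subring K) (l ^ (k + 1))) : subringNotDvd K p l hl k ≠ ⊤ := by
  obtain ⟨u, -, hu⟩ := h
  intro htop
  exact (hu.mem_subringNotDvd_iff (hl := hl) (pow_pos hl.pos _)).1
    (htop ▸ Subring.mem_top u) dvd_rfl

/-! ### Maximal subrings of algebraic extensions of `𝔽_p` -/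

section Algebraic

variable [Algebra (ZMod p) K] [Algebra.IsAlgebraic (ZMod p) K]

/-- By algebraicity the subring generated by `s` is a finite field, and its unit group is cyclic. -/
lemma exists_hasPrimitiveRoot_closure (s : Finset K) :
    ∃ N, 0 < N ∧ HasPrimitiveRoot p (Subring.closure (s : Set K)) N ∧ ∀ x ∈ s, x ^ p ^ N = x := by
  let L := IntermediateField.adjoin (ZMod p) (s : Set K)
  have hL : L.toSubalgebra = Algebra.adjoin (ZMod p) (s : Set K) :=
    IntermediateField.adjoin_toSubalgebra_of_isAlgebraic
      fun x _ => Algebra.IsAlgebraic.isAlgebraic x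
  have : FiniteDimensional (ZMod p) L := IntermediateField.finiteDimensional_adjoin
    fun x _ => Algebra.IsIntegral.isIntegral x
  have : Finite L := Module.finite_of_finite (ZMod p)
  have := Fintype.ofFinite L
  have : CharP L p := charP_of_injective_algebraMap (algebraMap (ZMod p) L).injective p
  obtain ⟨N, -, hN⟩ := FiniteField.card L p
  refine ⟨N, N.pos, ?_, fun x hx => ?_⟩
  · obtain ⟨g, hg⟩ := IsCyclic.exists_generator (α := Lˣ)
    have hgp : IsPrimitiveRoot g (p ^ (N : ℕ) - 1) := by
      rw [← hN, ← Nat.card_eq_fintype_card, ← Nat.card_units,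
        ← orderOf_eq_card_of_forall_mem_zpowers hg]
      exact IsPrimitiveRoot.orderOf g
    refine ⟨((g : L) : K), ?_, (IsPrimitiveRoot.coe_units_iff.2 hgp).map_of_injective
      (f := algebraMap L K) (algebraMap L K).injective⟩
    have hmem : ((g : L) : K) ∈ Algebra.adjoin (ZMod p) (s : Set K) := hL ▸ (g : L).2
    generalize ((g : L) : K) = y at hmem
    induction hmem using Algebra.adjoin_induction with
    | mem x hx => exact Subring.subset_closure hx
    | algebraMap c =>
      obtain ⟨n, rfl⟩ := ZMod.intCast_surjective c
      rw [map_intCast]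
      exact intCast_mem _ n
    | add x y _ _ hx hy => exact add_mem hx hy
    | mul x y _ _ hx hy => exact mul_mem hx hy
  · have hxL : x ∈ L := IntermediateField.subset_adjoin _ _ hx
    have := FiniteField.pow_card (⟨x, hxL⟩ : L)
    rw [hN] at this
    exact congrArg Subtype.val this

lemma exists_hasPrimitiveRoot_of_mem {B : Subring K} {x : K} (hx : x ∈ B) :
    ∃ N, 0 < N ∧ HasPrimitiveRoot p B N ∧ x ^ p ^ N = x := by
  obtain ⟨N, hN, hr, h⟩ := exists_hasPrimitiveRoot_closure (p := p) {x}
  exact ⟨N, hN, hr.mono (Subring.closure_le.2 (by simpa using hx)), h x (by simp)⟩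

lemma HasPrimitiveRoot.mul_of_coprime {B : Subring K} {m n : ℕ} (hm : 0 < m) (hn : 0 < n)
    (hmn : m.Coprime n) (h : HasPrimitiveRoot p B m) (h' : HasPrimitiveRoot p B n) :
    HasPrimitiveRoot p B (m * n) := by
  classical
  obtain ⟨u, hu, hup⟩ := h
  obtain ⟨v, hv, hvp⟩ := h'
  obtain ⟨N, hN, hr, h⟩ := exists_hasPrimitiveRoot_closure (p := p) {u, v}
  refine (hr.mono (Subring.closure_le.2 ?_)).of_dvd hN
    (hmn.mul_dvd_of_dvd_of_dvd (hup.dvd_of_pow_prime_pow_eq_self hm (h u (by simp)))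
      (hvp.dvd_of_pow_prime_pow_eq_self hn (h v (by simp))))
  intro x hx
  rcases (by simpa using hx : x = u ∨ x = v) with rfl | rfl
  exacts [hu, hv]

lemma HasPrimitiveRoot.of_prime_pow {B : Subring K} {n : ℕ} (hn : 0 < n)
    (h : ∀ l k : ℕ, l.Prime → l ^ (k + 1) ∣ n → HasPrimitiveRoot p B (l ^ (k + 1))) :
    HasPrimitiveRoot p B n := by
  induction n using Nat.recOnPrimeCoprime with
  | zero => exact absurd hn (lt_irrefl 0)
  | prime_pow l k hl =>
    cases k with
    | zero =>
      obtain ⟨N, hN, hr, -⟩ := exists_hasPrimitiveRoot_of_mem (p := p) (one_mem B)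
      exact hr.of_dvd hN (by simp)
    | succ k => exact h l k hl dvd_rfl
  | coprime a b ha hb hab iha ihb =>
    exact (iha (by omega) fun l k hl hd => h l k hl (hd.mul_right b)).mul_of_coprime (by omega)
      (by omega) hab (ihb (by omega) fun l k hl hd => h l k hl (hd.mul_left a))

variable [CharP K p]

/-- A strictly larger `T` contains a finite field of degree divisible by `l ^ (k + 1)`, the full
`l`-part available in `K`. The prime-to-`l` part is already in the subring, so `T` contains every
finite subfield. -/
lemma subringNotDvd_mem_RgMax {l : ℕ} (hl : l.Prime) {k : ℕ}
    (h1 : HasPrimitiveRoot p (⊤ : Subring K) (l ^ (k + 1)))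
    (h2 : ¬ HasPrimitiveRoot p (⊤ : Subring K) (l ^ (k + 2))) :
    subringNotDvd K p l hl k ∈ RgMax K := by
  refine ⟨subringNotDvd_ne_top h1, fun T hT => eq_top_iff.2 fun z _ => ?_⟩
  obtain ⟨y, hyT, hy⟩ := SetLike.exists_of_lt hT
  obtain ⟨N, hN, hrN, hyN⟩ := exists_hasPrimitiveRoot_of_mem (p := p) hyT
  have hdN : l ^ (k + 1) ∣ N := by
    by_contra hd
    exact hy ⟨N, ⟨hN, hd⟩, hyN⟩
  obtain ⟨n, hn, hrn, hzn⟩ := exists_hasPrimitiveRoot_of_mem (p := p) (Subring.mem_top z)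
  obtain ⟨j, m, hm, rfl⟩ := Nat.exists_eq_pow_mul_and_not_dvd hn.ne' l hl.ne_one
  have hm0 : 0 < m := Nat.pos_of_mul_pos_left hn
  have hj : j ≤ k + 1 := by
    by_contra hj
    exact h2 (hrn.of_dvd hn ((pow_dvd_pow l (by omega)).mul_right m))
  have hrm : HasPrimitiveRoot p T m := by
    obtain ⟨w, -, hw⟩ := hrn.of_dvd hn (dvd_mul_left m _)
    exact ⟨w, hT.le ((hw.mem_subringNotDvd_iff hm0).2
      fun hd => hm ((dvd_pow_self l k.succ_ne_zero).trans hd)), hw⟩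
  have hrl : HasPrimitiveRoot p T (l ^ j) :=
    hrN.of_dvd hN ((pow_dvd_pow l hj).trans hdN)
  exact (hrl.mul_of_coprime (pow_pos hl.pos _) hm0
    (Nat.Coprime.pow_left _ ((Nat.Prime.coprime_iff_not_dvd hl).2 hm)) hrm).mem hn hzn

lemma exists_eq_subringNotDvd_of_mem_RgMax {S : Subring K} (hS : S ∈ RgMax K) :
    ∃ (l : ℕ) (hl : l.Prime) (k : ℕ), HasPrimitiveRoot p (⊤ : Subring K) (l ^ (k + 1)) ∧
      ¬ HasPrimitiveRoot p (⊤ : Subring K) (l ^ (k + 2)) ∧ S = subringNotDvd K p l hl k := by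
  obtain ⟨z, -, hz⟩ := SetLike.exists_of_lt hS.lt_top
  obtain ⟨n, hn, hrn, hzn⟩ := exists_hasPrimitiveRoot_of_mem (p := p) (Subring.mem_top z)
  -- Otherwise `S` would contain the field with `p ^ n` elements, and hence `z`.
  obtain ⟨l, k, hl, hd, hlS⟩ : ∃ l k : ℕ, l.Prime ∧ l ^ (k + 1) ∣ n ∧
      ¬ HasPrimitiveRoot p S (l ^ (k + 1)) := by
    by_contra! hall
    exact hz ((HasPrimitiveRoot.of_prime_pow hn hall).mem hn hzn)
  have hK : HasPrimitiveRoot p (⊤ : Subring K) (l ^ (k + 1)) :=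
    hrn.of_dvd hn hd
  have hSle : S ≤ subringNotDvd K p l hl k := by
    intro x hx
    obtain ⟨m, hm, hrm, hxm⟩ := exists_hasPrimitiveRoot_of_mem (p := p) hx
    exact ⟨m, ⟨hm, fun hd => hlS (hrm.of_dvd hm hd)⟩, hxm⟩
  have hSeq : S = subringNotDvd K p l hl k :=
    (hS.le_iff.1 hSle).resolve_left (subringNotDvd_ne_top hK) |>.symm
  refine ⟨l, hl, k, hK, fun h2 => ?_, hSeq⟩
  -- If `l ^ (k + 2)` also occurred in `K`, the proper subring for `k + 1` would strictly contain
  -- `S`.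
  have hle : S ≤ subringNotDvd K p l hl (k + 1) := by
    rw [hSeq]
    rintro x ⟨m, ⟨hm, hd⟩, hx⟩
    exact ⟨m, ⟨hm, fun hd' => hd ((pow_dvd_pow l (k + 1).le_succ).trans hd')⟩, hx⟩
  have heq := (hS.le_iff.1 hle).resolve_left (subringNotDvd_ne_top h2)
  obtain ⟨u, -, hu⟩ := hK
  refine (hu.mem_subringNotDvd_iff (hl := hl) (pow_pos hl.pos _)).1 (?_ : u ∈ _) (dvd_refl _)
  rw [← hSeq, ← heq, hu.mem_subringNotDvd_iff (pow_pos hl.pos _)]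
  rw [Nat.pow_dvd_pow_iff_le_right hl.one_lt]
  omega

end Algebraic

/-- The prime powers `l ^ (k + 1)` that exactly divide the Steinitz degree of `K` over its prime
field. -/
def exactPrimePowers (K : Type*) [Field K] (p : ℕ) : Set (ℕ × ℕ) :=
  {a | a.1.Prime ∧ HasPrimitiveRoot p (⊤ : Subring K) (a.1 ^ (a.2 + 1)) ∧
    ¬ HasPrimitiveRoot p (⊤ : Subring K) (a.1 ^ (a.2 + 2))}

lemma injOn_fst_exactPrimePowers : Set.InjOn Prod.fst (exactPrimePowers K p) := by
  have key {l j k : ℕ} (hj : (l, j) ∈ exactPrimePowers K p) (hk : (l, k) ∈ exactPrimePowers K p) :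
      k ≤ j := by
    by_contra hlt
    exact hj.2.2 (hk.2.1.of_dvd (pow_pos hj.1.pos _)
      (pow_dvd_pow l (by dsimp only; omega)))
  rintro ⟨l, j⟩ hj ⟨l', k⟩ hk (rfl : l = l')
  exact Prod.ext rfl (le_antisymm (key hk hj) (key hj hk))

lemma finite_exactPrimePowers_inter_le (d : ℕ) :
    (exactPrimePowers K p ∩ {a | a.1 ≤ d}).Finite := by
  refine Set.Finite.of_finite_image ((Set.finite_Iic d).subset ?_)
    (injOn_fst_exactPrimePowers.mono Set.inter_subset_left)
  rintro _ ⟨a, ha, rfl⟩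
  exact ha.2

lemma RgMax_finite_iff_exactPrimePowers_finite [Algebra (ZMod p) K]
    [Algebra.IsAlgebraic (ZMod p) K] :
    (RgMax K).Finite ↔ (exactPrimePowers K p).Finite := by
  have : CharP K p := charP_of_injective_algebraMap (algebraMap (ZMod p) K).injective p
  let f : exactPrimePowers K p → RgMax K := fun a =>
    ⟨subringNotDvd K p a.1.1 a.2.1 a.1.2, subringNotDvd_mem_RgMax a.2.1 a.2.2.1 a.2.2.2⟩
  have hf : Function.Bijective f := by
    refine ⟨?_, ?_⟩
    · rintro ⟨⟨l, k⟩, hl, ha1, ha2⟩ ⟨⟨l', k'⟩, hl', hb1, hb2⟩ hab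
      have heq : subringNotDvd K p l hl k = subringNotDvd K p l' hl' k' := congrArg Subtype.val hab
      refine Subtype.ext (injOn_fst_exactPrimePowers ⟨hl, ha1, ha2⟩ ⟨hl', hb1, hb2⟩ ?_)
      by_contra hne
      obtain ⟨u, -, hu⟩ := ha1
      refine (hu.mem_subringNotDvd_iff (hl := hl) (pow_pos hl.pos _)).1 (?_ : u ∈ _) (dvd_refl _)
      rw [heq, hu.mem_subringNotDvd_iff (pow_pos hl.pos _)]
      intro hd
      exact hne ((Nat.prime_dvd_prime_iff_eq hl' hl).1
        (hl'.dvd_of_dvd_pow ((dvd_pow_self l' k'.succ_ne_zero).trans hd))).symm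
    · rintro ⟨S, hS⟩
      obtain ⟨l, hl, k, h1, h2, rfl⟩ := exists_eq_subringNotDvd_of_mem_RgMax (p := p) hS
      exact ⟨⟨(l, k), hl, h1, h2⟩, rfl⟩
  exact (Equiv.ofBijective f hf).symm.finite_iff

end PrimitiveRoots

/-! ### Finite extensions -/

section FiniteExtension

variable {F K : Type*} [Field F] [Field K] [Algebra F K] {p : ℕ}

lemma HasPrimitiveRoot.top_of_algebra {n : ℕ} (h : HasPrimitiveRoot p (⊤ : Subring F) n) :
    HasPrimitiveRoot p (⊤ : Subring K) n :=
  let ⟨u, _, hu⟩ := h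
  ⟨algebraMap F K u, trivial, hu.map_of_injective (algebraMap F K).injective⟩

variable [Fact p.Prime]

/-- Iterates of a power of Frobenius that fixes the coefficients of a polynomial return each root
to itself after at most `natDegree` steps. -/
lemma exists_pow_pow_eq_self_of_root [CharP F p] [CharP K p] {f : Polynomial F} (hf : f ≠ 0) {u : K}
    (hu : Polynomial.aeval u f = 0) {N : ℕ} (hN : ∀ c ∈ f.coeffs, c ^ p ^ N = c) :
    ∃ i, 0 < i ∧ i ≤ f.natDegree ∧ u ^ p ^ (N * i) = u := by
  have hfix : f.map (iterateFrobenius F p N) = f := by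
    ext i
    rw [Polynomial.coeff_map, iterateFrobenius_def]
    by_cases h0 : f.coeff i = 0
    · rw [h0, zero_pow (pow_ne_zero _ (Fact.out : p.Prime).ne_zero)]
    · exact hN _ (Polynomial.coeff_mem_coeffs h0)
  have hcomp : (iterateFrobenius K p N).comp (algebraMap F K) =
      (algebraMap F K).comp (iterateFrobenius F p N) := by
    ext c
    simp [iterateFrobenius_def]
  have hstep {v : K} (hv : Polynomial.aeval v f = 0) : Polynomial.aeval (v ^ p ^ N) f = 0 := by
    have := congrArg (iterateFrobenius K p N) hv
    rw [Polynomial.aeval_def, Polynomial.hom_eval₂, hcomp, ← Polynomial.eval₂_map, hfix,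
      map_zero, iterateFrobenius_def] at this
    exact this
  have hroot (i : ℕ) : Polynomial.aeval (u ^ p ^ (N * i)) f = 0 := by
    induction i with
    | zero => simpa using hu
    | succ i ih => rw [Nat.mul_succ, pow_add, pow_mul]; exact hstep ih
  classical
  have hf' : f.map (algebraMap F K) ≠ 0 :=
    (Polynomial.map_ne_zero_iff (algebraMap F K).injective).2 hf
  -- Pigeonhole: `natDegree + 1` iterates land among at most `natDegree` roots.
  obtain ⟨i, hi, j, hj, hne, hij⟩ := Finset.exists_ne_map_eq_of_card_lt_of_maps_to
    (s := Finset.range (f.natDegree + 1)) (t := (f.map (algebraMap F K)).roots.toFinset)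
    (f := fun i => u ^ p ^ (N * i)) (by
      rw [Finset.card_range, Nat.lt_succ_iff]
      exact (Multiset.toFinset_card_le _).trans
        ((Polynomial.card_roots' _).trans Polynomial.natDegree_map_le)) (fun i _ => by
      simpa [Polynomial.mem_roots hf', Polynomial.IsRoot.def, ← Polynomial.aeval_def,
        Polynomial.eval_map] using hroot i)
  wlog hlt : i < j generalizing i j
  · exact this j hj i hi hne.symm hij.symm (by omega)
  refine ⟨j - i, by omega, by have := Finset.mem_range.1 hj; omega, ?_⟩
  apply (iterateFrobenius K p (N * i)).injective
  rw [iterateFrobenius_def, iterateFrobenius_def, ← pow_mul, ← pow_add, ← mul_add,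
    Nat.sub_add_cancel hlt.le]
  exact hij.symm

/-- The coefficients of the minimal polynomial of `u` lie in a subfield of `F` with `p ^ N`
elements. Hence `l ^ k ∣ N * i` for some positive `i ≤ [K:F] < l`, and `i` is coprime to `l`. -/
lemma HasPrimitiveRoot.of_finrank_lt [FiniteDimensional F K] [Algebra (ZMod p) F]
    [Algebra.IsAlgebraic (ZMod p) F] {l k : ℕ} (hl : l.Prime) (hlt : Module.finrank F K < l)
    (h : HasPrimitiveRoot p (⊤ : Subring K) (l ^ k)) :
    HasPrimitiveRoot p (⊤ : Subring F) (l ^ k) := by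
  have : CharP F p := charP_of_injective_algebraMap (algebraMap (ZMod p) F).injective p
  have : CharP K p := charP_of_injective_algebraMap (algebraMap F K).injective p
  obtain ⟨u, -, hu⟩ := h
  have hint : IsIntegral F u := Algebra.IsIntegral.isIntegral u
  obtain ⟨N, hN, hr, hfix⟩ := exists_hasPrimitiveRoot_closure (p := p) (minpoly F u).coeffs
  obtain ⟨i, hi0, hi, hui⟩ := exists_pow_pow_eq_self_of_root (minpoly.ne_zero hint)
    (minpoly.aeval F u) hfix
  have hd : l ^ k ∣ N * i := hu.dvd_of_pow_prime_pow_eq_self (pow_pos hl.pos _) hui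
  have hil : i < l := hi.trans_lt ((minpoly.natDegree_le u).trans_lt hlt)
  have hcop : (l ^ k).Coprime i :=
    Nat.Coprime.pow_left _ ((Nat.Prime.coprime_iff_not_dvd hl).2 fun hli =>
      (Nat.le_of_dvd hi0 hli).not_gt hil)
  exact (hr.mono le_top).of_dvd hN (hcop.dvd_of_dvd_mul_right hd)

/-- A finite extension of fields that are algebraic over a finite prime field does not change
whether there are only finitely many maximal subrings. -/
lemma RgMax_finite_iff_of_finiteDimensional_of_isAlgebraic [FiniteDimensional F K]
    [Algebra (ZMod p) F] [Algebra.IsAlgebraic (ZMod p) F] [Algebra (ZMod p) K]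
    [Algebra.IsAlgebraic (ZMod p) K] : (RgMax K).Finite ↔ (RgMax F).Finite := by
  rw [RgMax_finite_iff_exactPrimePowers_finite (p := p),
    RgMax_finite_iff_exactPrimePowers_finite (p := p)]
  have hiff {l k : ℕ} (hl : l.Prime) (hlt : Module.finrank F K < l) :
      HasPrimitiveRoot p (⊤ : Subring K) (l ^ k) ↔ HasPrimitiveRoot p (⊤ : Subring F) (l ^ k) :=
    ⟨HasPrimitiveRoot.of_finrank_lt hl hlt, HasPrimitiveRoot.top_of_algebra⟩
  have hlarge : exactPrimePowers K p ∩ {a | Module.finrank F K < a.1} =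
      exactPrimePowers F p ∩ {a | Module.finrank F K < a.1} := by
    ext ⟨l, k⟩
    simp only [exactPrimePowers, Set.mem_inter_iff, Set.mem_ofPred_eq]
    refine and_congr_left fun hlt => and_congr_right fun hl => ?_
    rw [hiff hl hlt, hiff hl hlt]
  have hsplit (s : Set (ℕ × ℕ)) : s = s ∩ {a | a.1 ≤ Module.finrank F K} ∪
      s ∩ {a | Module.finrank F K < a.1} := by
    ext a
    simp [← and_or_left, le_or_gt]
  constructor
  · intro h
    rw [hsplit (exactPrimePowers F p), ← hlarge]
    exact (finite_exactPrimePowers_inter_le _).union (h.subset Set.inter_subset_left)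
  · intro h
    rw [hsplit (exactPrimePowers K p), hlarge]
    exact (finite_exactPrimePowers_inter_le _).union (h.subset Set.inter_subset_left)

end FiniteExtension

/-- A finite extension of fields does not change whether there are only finitely many maximal
subrings. -/
lemma RgMax_finite_iff_of_finiteDimensional (F K : Type*) [Field F] [Field K] [Algebra F K]
    [FiniteDimensional F K] : (RgMax K).Finite ↔ (RgMax F).Finite := by
  constructor
  · intro h
    obtain ⟨p, _, _, _⟩ := exists_isAlgebraic_zmod_of_RgMax_finite h
    have : CharP K p := charP_of_injective_algebraMap (algebraMap (ZMod p) K).injective p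
    have : CharP F p := (algebraMap F K).charP (algebraMap F K).injective p
    let _ := ZMod.algebra F p
    have : IsScalarTower (ZMod p) F K := IsScalarTower.of_algebraMap_eq' (Subsingleton.elim _ _)
    have : Algebra.IsAlgebraic (ZMod p) F := Algebra.IsAlgebraic.tower_bot (ZMod p) F K
    exact (RgMax_finite_iff_of_finiteDimensional_of_isAlgebraic (p := p)).1 h
  · intro h
    obtain ⟨p, _, _, _⟩ := exists_isAlgebraic_zmod_of_RgMax_finite h
    have : CharP F p := charP_of_injective_algebraMap (algebraMap (ZMod p) F).injective p
    have : CharP K p := charP_of_injective_algebraMap (algebraMap F K).injective p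
    let _ := ZMod.algebra K p
    have : IsScalarTower (ZMod p) F K := IsScalarTower.of_algebraMap_eq' (Subsingleton.elim _ _)
    have : Algebra.IsAlgebraic (ZMod p) K := Algebra.IsAlgebraic.trans (ZMod p) F K
    exact (RgMax_finite_iff_of_finiteDimensional_of_isAlgebraic (p := p)).2 h

/-! ### Extensions generated by finitely many elements -/

/-- A field with finitely many maximal subrings is algebraic over each of its subfields. -/
lemma isAlgebraic_of_RgMax_finite (F : Type*) {K : Type*} [Field F] [Field K] [Algebra F K]
    (h : (RgMax K).Finite) : Algebra.IsAlgebraic F K := by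
  obtain ⟨p, _, _, _⟩ := exists_isAlgebraic_zmod_of_RgMax_finite h
  have : CharP K p := charP_of_injective_algebraMap (algebraMap (ZMod p) K).injective p
  have : CharP F p := (algebraMap F K).charP (algebraMap F K).injective p
  let _ := ZMod.algebra F p
  have : IsScalarTower (ZMod p) F K := IsScalarTower.of_algebraMap_eq' (Subsingleton.elim _ _)
  exact Algebra.IsAlgebraic.tower_top (K := ZMod p) F

lemma isField_and_finite_adjoin_iff {F E : Type*} [Field F] [Field E] [Algebra F E] {s : Set E}
    [Finite s] : (∀ x ∈ s, IsAlgebraic F x) ↔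
      IsField (Algebra.adjoin F s) ∧ Module.Finite F (Algebra.adjoin F s) := by
  constructor
  · intro h
    have : FiniteDimensional F (Algebra.adjoin F s) :=
      Algebra.finite_adjoin_of_finite_of_isIntegral (Set.toFinite s) fun x hx => (h x hx).isIntegral
    exact ⟨isField_of_isIntegral_of_isField' (Field.toIsField F), this⟩
  · rintro ⟨-, _⟩ x hx
    exact (Algebra.IsAlgebraic.isAlgebraic (R := F)
      (⟨x, Algebra.subset_adjoin hx⟩ : Algebra.adjoin F s)).algebraMap

theorem theorem3p1 {F E : Type*} [Field F] [Field E] [Algebra F E] {n : ℕ} (α : Fin n → E) :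
    -- the field `K = F(α₁, …, αₙ)`
    ((RgMax (IntermediateField.adjoin F (Set.range α))).Finite ↔
      (RgMax F).Finite ∧ FiniteDimensional F (IntermediateField.adjoin F (Set.range α))) ∧
    -- the affine domain `R = F[α₁, …, αₙ]`
    ((RgMax (Algebra.adjoin F (Set.range α))).Finite ↔
      (RgMax F).Finite ∧ ∀ i, IsAlgebraic F (α i)) ∧
    -- all `αᵢ` are algebraic iff `R` is a field of finite degree over `F`
    ((∀ i, IsAlgebraic F (α i)) ↔
      IsField (Algebra.adjoin F (Set.range α)) ∧
        Module.Finite F (Algebra.adjoin F (Set.range α))) := by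
  have halg : (∀ i, IsAlgebraic F (α i)) ↔ IsField (Algebra.adjoin F (Set.range α)) ∧
      Module.Finite F (Algebra.adjoin F (Set.range α)) := by
    rw [← isField_and_finite_adjoin_iff, Set.forall_mem_range]
  refine ⟨⟨fun h => ?_, fun ⟨h, _⟩ => (RgMax_finite_iff_of_finiteDimensional F _).2 h⟩,
    ⟨fun h => ?_, fun ⟨h, hα⟩ => ?_⟩, halg⟩
  · have := isAlgebraic_of_RgMax_finite F h
    have : FiniteDimensional F (IntermediateField.adjoin F (Set.range α)) :=
      IntermediateField.finiteDimensional_adjoin fun x hx =>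
        ((Algebra.IsAlgebraic.isAlgebraic (R := F)
          (⟨x, IntermediateField.subset_adjoin F _ hx⟩ :
            IntermediateField.adjoin F (Set.range α))).algebraMap).isIntegral
    exact ⟨(RgMax_finite_iff_of_finiteDimensional F _).1 h, this⟩
  · have : Algebra.FiniteType F (Algebra.adjoin F (Set.range α)) :=
      Algebra.FiniteType.adjoin_of_finite (Set.finite_range α)
    have hfield := isField_of_RgMax_finite F h
    let _ := hfield.toField
    have : Module.Finite F (Algebra.adjoin F (Set.range α)) :=
      finite_of_finite_type_of_isJacobsonRing F _
    exact ⟨(RgMax_finite_iff_of_finiteDimensional F _).1 h, halg.2 ⟨hfield, this⟩⟩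
  · obtain ⟨hfield, _⟩ := halg.1 hα
    let _ := hfield.toField
    exact (RgMax_finite_iff_of_finiteDimensional F (Algebra.adjoin F (Set.range α))).2 h
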